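/- Let $n\ge 2$ and let $\mathfrak g=\mathfrak{sl}(n,\mathbb C)$, regarded as a $\mathfrak g$-module by the adjoint action. Let $\circledcirc^2\mathfrak g\subset\mathfrak g\otimes\mathfrak g$ be the Cartan product of $\mathfrak g$ with itself, i.e. the unique irreducible submodule of $\mathfrak g\otimes\mathfrak g$ whose highest weight is twice the highest weight of $\mathfrak g$, and let $X\otimes Y\mapsto X\circledcirc Y$ be the $\mathfrak g$-invariant projection of $\mathfrak g\otimes\mathfrak g$ onto $\circledcirc^2\mathfrak g$. Let $\Phi$ be the composition $$\Lambda^2\mathfrak g\otimes\mathfrak g\hookrightarrow\mathfrak g\otimes\mathfrak g\otimes\mathfrak g\xrightarrow{\ \mathrm{Id}\otimes(\cdot\,\circledcirc\,\cdot)\ }\mathfrak g\otimes\circledcirc^2\mathfrak g,$$ where $\Lambda^2\mathfrak g\subset\mathfrak g\otimes\mathfrak g$ is the space of skew tensors. Then $$\dim\mathrm{Hom}_{\mathfrak g}(\mathfrak g,\Lambda^2\mathfrak g\otimes\mathfrak g)=\begin{cases}4&\text{if }n\ge 3,\\ 1&\text{if }n=2,\end{cases}\qquad \dim\mathrm{Hom}_{\mathfrak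 g}(\mathfrak g,\mathfrak g\otimes\circledcirc^2\mathfrak g)=1\quad\text{for all }n\ge 2.$$ Moreover, if $n\ge 3$, then $\dim\mathrm{Hom}_{\mathfrak g}(\mathfrak g,\ker\Phi)\ge 3$. -/

import Mathlib

open scoped TensorProduct
open Module

namespace CartanSl
section General
variable (L : Type*) [LieRing L] [LieAlgebra ℂ L]

/-- `Λ²L ⊆ L ⊗ L`: the skew-symmetric tensors, as a Lie submodule. -/
def skewSquare : LieSubmodule ℂ L (L ⊗[ℂ] L) where
  carrier := {t | TensorProduct.comm ℂ L L t = -t}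
  add_mem' {a b} ha hb := by
    simp only [Set.mem_ofPred_eq] at *
    rw [map_add, ha, hb]; abel
  zero_mem' := by simp
  smul_mem' c x hx := by
    simp only [Set.mem_ofPred_eq] at *
    rw [map_smul, hx, smul_neg]
  lie_mem := by
    intro x t ht
    have key : ∀ s : L ⊗[ℂ] L,
        TensorProduct.comm ℂ L L ⁅x, s⁆ = ⁅x, TensorProduct.comm ℂ L L s⁆ := by
      intro s
      induction s using TensorProduct.induction_on with
      | zero => simp
      | tmul a b => simp [add_comm]
      | add a b ha hb => simp only [lie_add, map_add, ha, hb]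
    change TensorProduct.comm ℂ L L ⁅x, t⁆ = -⁅x, t⁆
    have ht' : TensorProduct.comm ℂ L L t = -t := ht
    rw [key, ht', lie_neg]

/-- The associativity isomorphism of tensor products, as a morphism of Lie modules. -/
noncomputable def tensorAssoc : (L ⊗[ℂ] L) ⊗[ℂ] L →ₗ⁅ℂ, L⁆ L ⊗[ℂ] (L ⊗[ℂ] L) :=
  { (TensorProduct.assoc ℂ L L L).toLinearMap with
    map_lie' := by
      intro x t
      change TensorProduct.assoc ℂ L L L ⁅x, t⁆ = ⁅x, TensorProduct.assoc ℂ L L L t⁆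
      induction t using TensorProduct.induction_on with
      | zero => simp
      | add a b ha hb => simp only [lie_add, map_add, ha, hb]
      | tmul s c =>
        induction s using TensorProduct.induction_on with
        | zero => simp
        | add a b ha hb =>
          simp only [TensorProduct.add_tmul, lie_add, map_add, ha, hb]
        | tmul a b =>
          simp [TensorProduct.add_tmul, TensorProduct.tmul_add, add_assoc] }
end General

/-- The Lie algebra `sl(n, ℂ)` of traceless complex `n × n` matrices. -/
abbrev sl (n : ℕ) := LieAlgebra.SpecialLinear.sl (Fin n) ℂ

/-- The elementary matrix `E_{1n}`, the highest root vector of `sl(n, ℂ)` (for the Borel subalgebra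
of upper triangular matrices), i.e. a highest weight vector of the adjoint representation. -/
noncomputable def highestRootVector (n : ℕ) (hn : 2 ≤ n) : sl n :=
  LieAlgebra.SpecialLinear.single (⟨0, by omega⟩ : Fin n) ⟨n - 1, by omega⟩
    (by simp [Fin.ext_iff]; omega) (1 : ℂ)

section

attribute [local instance 100] LieRing.ofAssociativeRing

/-- Every strictly upper triangular matrix annihilates the highest root vector. -/
theorem lie_highestRootVector_eq_zero (n : ℕ) (hn : 2 ≤ n) (x : sl n)
    (hx : ∀ i j, j ≤ i → x.1 i j = 0) : ⁅x, highestRootVector n hn⁆ = 0 := by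
  apply Subtype.ext
  ext i j
  change (⁅x, highestRootVector n hn⁆ : sl n).1 i j = 0
  rw [LieAlgebra.SpecialLinear.sl_bracket, Matrix.sub_apply, Matrix.mul_apply, Matrix.mul_apply,
    Finset.sum_eq_zero, Finset.sum_eq_zero, sub_zero]
  · intro k _
    simp only [highestRootVector, LieAlgebra.SpecialLinear.val_single, Matrix.single_apply]
    split_ifs with h
    · rw [hx k j (by simp only [Fin.ext_iff, Fin.le_def] at *; omega), mul_zero]
    · rw [zero_mul]
  · intro k _
    simp only [highestRootVector, LieAlgebra.SpecialLinear.val_single, Matrix.single_apply]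
    split_ifs with h
    · rw [hx i k (by simp only [Fin.ext_iff, Fin.le_def] at *; omega), zero_mul]
    · rw [mul_zero]

/-- A diagonal matrix `diag(h₁, …, hₙ)` acts on the highest root vector by `h₁ - hₙ`. -/
theorem lie_diagonal_highestRootVector (n : ℕ) (hn : 2 ≤ n) (x : sl n) (d : Fin n → ℂ)
    (hx : x.1 = Matrix.diagonal d) :
    ⁅x, highestRootVector n hn⁆ =
      (d ⟨0, by omega⟩ - d ⟨n - 1, by omega⟩) • highestRootVector n hn := by
  apply Subtype.ext
  ext i j
  change (⁅x, highestRootVector n hn⁆ : sl n).1 i j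
    = (d ⟨0, by omega⟩ - d ⟨n - 1, by omega⟩) * (highestRootVector n hn).1 i j
  rw [LieAlgebra.SpecialLinear.sl_bracket, hx]
  simp only [highestRootVector, LieAlgebra.SpecialLinear.val_single, Matrix.sub_apply,
    Matrix.diagonal_mul, Matrix.mul_diagonal, Matrix.single_apply]
  split_ifs with h
  · rw [← h.1, ← h.2]; ring
  · ring

end

/-- The Cartan square `⊚²g ⊆ g ⊗ g` of `g = sl(n, ℂ)`: the irreducible component whose highest weight
is twice the highest weight of `g`, i.e. the submodule generated by the tensor square of the highest
weight vector of `g`. -/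
noncomputable def cartanSquare (n : ℕ) (hn : 2 ≤ n) : LieSubmodule ℂ (sl n) (sl n ⊗[ℂ] sl n) :=
  LieSubmodule.lieSpan ℂ (sl n) {highestRootVector n hn ⊗ₜ[ℂ] highestRootVector n hn}


section Projection

attribute [local instance 100] LieRing.ofAssociativeRing

/-- The coordinates of a tensor in `sl(n, ℂ) ⊗ sl(n, ℂ)`, as a vector in Hermitian space. -/
noncomputable def coords (n : ℕ) : sl n ⊗[ℂ] sl n →ₗ[ℂ]
    EuclideanSpace ℂ ((Fin n × Fin n) × (Fin n × Fin n)) :=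
  (WithLp.linearEquiv 2 ℂ _).symm.toLinearMap ∘ₗ
    ((Matrix.stdBasis ℂ (Fin n) (Fin n)).tensorProduct
      (Matrix.stdBasis ℂ (Fin n) (Fin n))).equivFun.toLinearMap ∘ₗ
    TensorProduct.map (sl n).toSubmodule.subtype (sl n).toSubmodule.subtype

theorem coords_tmul (n : ℕ) (X Y : sl n) (p : (Fin n × Fin n) × (Fin n × Fin n)) :
    coords n (X ⊗ₜ Y) p = X.1 p.1.1 p.1.2 * Y.1 p.2.1 p.2.2 := by
  obtain ⟨⟨i, j⟩, ⟨k, l⟩⟩ := p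
  have h : ∀ (A : Matrix (Fin n) (Fin n) ℂ) (i j : Fin n),
      (Matrix.stdBasis ℂ (Fin n) (Fin n)).repr A (i, j) = A i j := by
    intro A i j
    simp [Matrix.stdBasis]
  simp [coords, h, mul_comm]
  rfl

theorem coords_injective (n : ℕ) : Function.Injective (coords n) := by
  have h : Function.Injective (TensorProduct.map (sl n).toSubmodule.subtype
      (sl n).toSubmodule.subtype) :=
    TensorProduct.map_injective_of_flat_flat _ _ Subtype.val_injective Subtype.val_injective
  have h2 := ((Matrix.stdBasis ℂ (Fin n) (Fin n)).tensorProduct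
      (Matrix.stdBasis ℂ (Fin n) (Fin n))).equivFun.injective
  have h3 := (WithLp.linearEquiv 2 ℂ ((Fin n × Fin n) × (Fin n × Fin n) → ℂ)).symm.injective
  exact h3.comp (h2.comp h)

/-- The conjugate transpose on `sl(n, ℂ)`. -/
def adj {n : ℕ} (x : sl n) : sl n :=
  ⟨x.1.conjTranspose, by
    have h : x.1.trace = 0 := x.2
    change x.1.conjTranspose.trace = 0
    rw [Matrix.trace_conjTranspose, h, star_zero]⟩

theorem adj_adj {n : ℕ} (x : sl n) : adj (adj x) = x :=
  Subtype.ext (Matrix.conjTranspose_conjTranspose _)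

theorem inner_coords_tmul (n : ℕ) (X Y X' Y' : sl n) :
    inner ℂ (coords n (X ⊗ₜ Y)) (coords n (X' ⊗ₜ Y')) =
      (X.1.conjTranspose * X'.1).trace * (Y.1.conjTranspose * Y'.1).trace := by
  simp only [PiLp.inner_apply, coords_tmul, RCLike.inner_apply, Fintype.sum_prod_type,
    Matrix.trace, Matrix.diag, Matrix.mul_apply, Matrix.conjTranspose_apply,
    map_mul]
  rw [Finset.sum_comm (f := fun i j => star (X.1 j i) * X'.1 j i),
    Finset.sum_comm (f := fun i j => star (Y.1 j i) * Y'.1 j i)]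
  simp only [Finset.sum_mul]
  simp only [Finset.mul_sum, starRingEnd_apply]
  refine Finset.sum_congr rfl fun i _ => Finset.sum_congr rfl fun j _ =>
    Finset.sum_congr rfl fun k _ => Finset.sum_congr rfl fun l _ => ?_
  ring

theorem inner_coords_lie (n : ℕ) (x : sl n) (s t : sl n ⊗[ℂ] sl n) :
    inner ℂ (coords n s) (coords n ⁅x, t⁆) = inner ℂ (coords n ⁅adj x, s⁆) (coords n t) := by
  have key : ∀ A B : sl n, (A.1.conjTranspose * (⁅x, B⁆ : sl n).1).trace =
      ((⁅adj x, A⁆ : sl n).1.conjTranspose * B.1).trace := by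
    intro A B
    rw [LieAlgebra.SpecialLinear.sl_bracket, LieAlgebra.SpecialLinear.sl_bracket]
    simp only [adj, Matrix.conjTranspose_sub, Matrix.conjTranspose_mul,
      Matrix.conjTranspose_conjTranspose, mul_sub, sub_mul, Matrix.trace_sub, Matrix.mul_assoc]
    congr 1
    rw [Matrix.trace_mul_comm x.1, Matrix.mul_assoc]
  induction s using TensorProduct.induction_on with
  | zero => simp
  | add a b ha hb => simp only [lie_add, map_add, inner_add_left, ha, hb]
  | tmul A A' =>
    induction t using TensorProduct.induction_on with
    | zero => simp
    | add a b ha hb => simp only [lie_add, map_add, inner_add_right, ha, hb]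
    | tmul B B' =>
      simp only [TensorProduct.LieModule.lie_tmul_right, map_add, inner_add_left, inner_add_right,
        inner_coords_tmul, key]

/-- The orthogonal complement of a submodule, with respect to the standard Hermitian form. -/
noncomputable def orthCompl {n : ℕ} (N : LieSubmodule ℂ (sl n) (sl n ⊗[ℂ] sl n)) :
    LieSubmodule ℂ (sl n) (sl n ⊗[ℂ] sl n) where
  __ := ((N.toSubmodule.map (coords n))ᗮ).comap (coords n)
  lie_mem := by
    intro x t ht
    simp only [AddSubsemigroup.mem_carrier, AddSubmonoid.mem_toSubsemigroup,
      Submodule.mem_toAddSubmonoid, Submodule.mem_comap, Submodule.mem_orthogonal] at ht ⊢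
    rintro _ ⟨s, hs, rfl⟩
    rw [inner_coords_lie]
    exact ht _ ⟨_, N.lie_mem hs, rfl⟩

theorem mem_orthCompl {n : ℕ} {N : LieSubmodule ℂ (sl n) (sl n ⊗[ℂ] sl n)}
    {t : sl n ⊗[ℂ] sl n} :
    t ∈ orthCompl N ↔ ∀ s ∈ N, inner ℂ (coords n s) (coords n t) = 0 := by
  change coords n t ∈ (N.toSubmodule.map (coords n))ᗮ ↔ _
  rw [Submodule.mem_orthogonal]
  constructor
  · exact fun h s hs => h _ ⟨s, hs, rfl⟩
  · rintro h _ ⟨s, hs, rfl⟩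
    exact h s hs

theorem isCompl_orthCompl {n : ℕ} (N : LieSubmodule ℂ (sl n) (sl n ⊗[ℂ] sl n)) :
    IsCompl N.toSubmodule (orthCompl N).toSubmodule := by
  constructor
  · rw [Submodule.disjoint_def]
    intro t h1 h2
    have := mem_orthCompl.1 h2 t h1
    rw [inner_self_eq_zero] at this
    exact coords_injective n (by rw [this, map_zero])
  · rw [codisjoint_iff, eq_top_iff]
    intro t _
    obtain ⟨a, ⟨c, hc, rfl⟩, b, hb, hab⟩ :=
      (N.toSubmodule.map (coords n)).exists_add_mem_mem_orthogonal (coords n t)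
    refine Submodule.mem_sup.2 ⟨c, hc, t - c, ?_, by abel⟩
    change coords n (t - c) ∈ (N.toSubmodule.map (coords n))ᗮ
    rw [map_sub, hab, add_sub_cancel_left]
    exact hb

/-- The coroot `E_{11} - E_{nn}`. -/
noncomputable def coroot (n : ℕ) (hn : 2 ≤ n) : sl n :=
  LieAlgebra.SpecialLinear.singleSubSingle (⟨0, by omega⟩ : Fin n) ⟨n - 1, by omega⟩ (1 : ℂ)

/-- The diagonal entries of `E_{11} - E_{nn}`. -/
def corootEntry {n : ℕ} (i : Fin n) : ℤ :=
  if i.1 = 0 then 1 else if i.1 = n - 1 then -1 else 0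

theorem coroot_val (n : ℕ) (hn : 2 ≤ n) :
    (coroot n hn).1 = Matrix.diagonal fun i => (corootEntry i : ℂ) := by
  ext i j
  rw [coroot, LieAlgebra.SpecialLinear.val_singleSubSingle]
  simp only [Matrix.sub_apply, Matrix.single_apply, Matrix.diagonal_apply, corootEntry,
    Fin.ext_iff]
  split_ifs <;> first | omega | simp

theorem coords_coroot (n : ℕ) (hn : 2 ≤ n) (t : sl n ⊗[ℂ] sl n)
    (p : (Fin n × Fin n) × (Fin n × Fin n)) :
    coords n ⁅coroot n hn, t⁆ p = ((corootEntry p.1.1 - corootEntry p.1.2 + corootEntry p.2.1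
      - corootEntry p.2.2 : ℤ) : ℂ) * coords n t p := by
  induction t using TensorProduct.induction_on with
  | zero => simp
  | add a b ha hb => simp only [lie_add, map_add, PiLp.add_apply, ha, hb, mul_add]
  | tmul A B =>
    simp only [TensorProduct.LieModule.lie_tmul_right, map_add, PiLp.add_apply, coords_tmul,
      LieAlgebra.SpecialLinear.sl_bracket, coroot_val, Matrix.sub_apply,
      Matrix.diagonal_mul, Matrix.mul_diagonal]
    push_cast
    ring

theorem lie_coroot_highest (n : ℕ) (hn : 2 ≤ n) :
    ⁅coroot n hn, highestRootVector n hn⁆ = (2 : ℂ) • highestRootVector n hn := by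
  rw [lie_diagonal_highestRootVector n hn _ _ (coroot_val n hn)]
  have h : n - 1 ≠ 0 := by omega
  simp only [corootEntry, if_true, if_neg h]
  norm_num

/-- The tensor square of the highest root vector. -/
noncomputable def topTensor (n : ℕ) (hn : 2 ≤ n) : sl n ⊗[ℂ] sl n :=
  highestRootVector n hn ⊗ₜ[ℂ] highestRootVector n hn

theorem lie_coroot_top (n : ℕ) (hn : 2 ≤ n) :
    ⁅coroot n hn, topTensor n hn⁆ = (4 : ℂ) • topTensor n hn := by
  rw [topTensor, TensorProduct.LieModule.lie_tmul_right, lie_coroot_highest,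
    TensorProduct.tmul_smul, ← TensorProduct.smul_tmul', ← add_smul]
  norm_num

theorem eq_smul_top (n : ℕ) (hn : 2 ≤ n) (t : sl n ⊗[ℂ] sl n)
    (ht : ⁅coroot n hn, t⁆ = (4 : ℂ) • t) :
    ∃ c : ℂ, t = c • topTensor n hn := by
  let a : Fin n := ⟨0, by omega⟩
  let b : Fin n := ⟨n - 1, by omega⟩
  refine ⟨coords n t ((a, b), (a, b)), coords_injective n ?_⟩
  ext ⟨⟨i, j⟩, ⟨k, l⟩⟩
  have h := coords_coroot n hn t ((i, j), (k, l))
  rw [ht, map_smul, PiLp.smul_apply, smul_eq_mul] at h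
  rw [map_smul, PiLp.smul_apply, topTensor, coords_tmul, smul_eq_mul]
  simp only [highestRootVector, LieAlgebra.SpecialLinear.val_single, Matrix.single_apply]
  by_cases hp : (a = i ∧ b = j) ∧ (a = k ∧ b = l)
  · obtain ⟨⟨rfl, rfl⟩, rfl, rfl⟩ := hp
    simp [a, b]
  · have h0 : coords n t ((i, j), (k, l)) = 0 := by
      by_contra hne
      have h4 : (4 : ℂ) = ((corootEntry i - corootEntry j + corootEntry k - corootEntry l : ℤ) : ℂ) :=
        mul_right_cancel₀ hne h
      have h5 : (4 : ℤ) = corootEntry i - corootEntry j + corootEntry k - corootEntry l := by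
        exact_mod_cast h4
      apply hp
      simp only [corootEntry, a, b, Fin.ext_iff] at h5 ⊢
      split_ifs at h5 <;> omega
    rw [h0]
    simp only [a, b] at hp
    by_cases h1 : (⟨0, by omega⟩ : Fin n) = i ∧ (⟨n - 1, by omega⟩ : Fin n) = j
    · by_cases h2 : (⟨0, by omega⟩ : Fin n) = k ∧ (⟨n - 1, by omega⟩ : Fin n) = l
      · exact absurd ⟨h1, h2⟩ hp
      · rw [if_neg h2]; simp
    · rw [if_neg h1]; simp

theorem top_mem (n : ℕ) (hn : 2 ≤ n) : topTensor n hn ∈ cartanSquare n hn :=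
  LieSubmodule.subset_lieSpan (Set.mem_singleton _)

theorem exists_projection (n : ℕ) (hn : 2 ≤ n) :
    ∃ P : sl n ⊗[ℂ] sl n →ₗ⁅ℂ, sl n⁆ cartanSquare n hn, ∀ t : cartanSquare n hn, P t = t := by
  let C := cartanSquare n hn
  have hC := isCompl_orthCompl C
  let P := C.toSubmodule.projectionOnto (orthCompl C).toSubmodule hC
  have hP1 : ∀ t : C, P t.1 = t := fun t => Submodule.projectionOnto_apply_left hC t
  have hP2 : ∀ t ∈ orthCompl C, P t = 0 := fun t ht =>
    (Submodule.projectionOnto_apply_eq_zero_iff hC).2 ht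
  refine ⟨{ P with map_lie' := ?_ }, hP1⟩
  intro x t
  change P ⁅x, t⁆ = (⁅x, (P t : C)⁆ : C)
  have ht : t ∈ C.toSubmodule ⊔ (orthCompl C).toSubmodule := by
    rw [hC.sup_eq_top]; trivial
  obtain ⟨a, ha, b, hb, rfl⟩ := Submodule.mem_sup.1 ht
  rw [lie_add, map_add, map_add, hP2 b hb, hP2 _ ((orthCompl C).lie_mem hb), hP1 ⟨a, ha⟩,
    add_zero, add_zero]
  exact hP1 ⁅x, (⟨a, ha⟩ : C)⁆

theorem cartanSquare_le {n : ℕ} {hn : 2 ≤ n} {N : LieSubmodule ℂ (sl n) (sl n ⊗[ℂ] sl n)}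
    (h : topTensor n hn ∈ N) : cartanSquare n hn ≤ N :=
  LieSubmodule.lieSpan_le.2 (Set.singleton_subset_iff.2 h)

/-- A Lie submodule either contains the top tensor or is orthogonal to it. -/
theorem mem_or_mem (n : ℕ) (hn : 2 ≤ n) (N : LieSubmodule ℂ (sl n) (sl n ⊗[ℂ] sl n)) :
    topTensor n hn ∈ N ∨ topTensor n hn ∈ orthCompl N := by
  have hN := isCompl_orthCompl N
  have ht : topTensor n hn ∈ N.toSubmodule ⊔ (orthCompl N).toSubmodule := by
    rw [hN.sup_eq_top]; trivial
  obtain ⟨a, ha, b, hb, hab⟩ := Submodule.mem_sup.1 ht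
  have h := lie_coroot_top n hn
  rw [← hab, lie_add, smul_add] at h
  have hd := Submodule.disjoint_def.1 hN.disjoint (⁅coroot n hn, a⁆ - (4 : ℂ) • a)
    (sub_mem (N.lie_mem ha) (N.smul_mem _ ha))
    (by
      have : ⁅coroot n hn, a⁆ - (4 : ℂ) • a = (4 : ℂ) • b - ⁅coroot n hn, b⁆ := by
        rw [sub_eq_sub_iff_add_eq_add, h, add_comm]
      rw [this]
      exact sub_mem ((orthCompl N).smul_mem _ hb) ((orthCompl N).lie_mem hb))
  obtain ⟨c, hc⟩ := eq_smul_top n hn a (sub_eq_zero.1 hd)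
  by_cases h0 : c = 0
  · right
    rw [h0, zero_smul] at hc
    rw [← hab, hc, zero_add]
    exact hb
  · left
    have : topTensor n hn = c⁻¹ • a := by rw [hc, smul_smul, inv_mul_cancel₀ h0, one_smul]
    rw [this]
    exact N.smul_mem _ ha

theorem top_ne_zero (n : ℕ) (hn : 2 ≤ n) : topTensor n hn ≠ 0 := by
  intro h
  have := coords_tmul n (highestRootVector n hn) (highestRootVector n hn)
    ((⟨0, by omega⟩, ⟨n - 1, by omega⟩), (⟨0, by omega⟩, ⟨n - 1, by omega⟩))
  rw [← topTensor, h] at this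
  simp [highestRootVector] at this

/-- The Cartan square is irreducible: a nonzero submodule of it is everything. -/
theorem eq_cartanSquare_of_le (n : ℕ) (hn : 2 ≤ n)
    (N : LieSubmodule ℂ (sl n) (sl n ⊗[ℂ] sl n)) (hN : N ≤ cartanSquare n hn) (h0 : N ≠ ⊥) :
    N = cartanSquare n hn := by
  rcases mem_or_mem n hn N with h | h
  · exact le_antisymm hN (cartanSquare_le h)
  · exfalso
    apply h0
    rw [LieSubmodule.eq_bot_iff]
    intro t ht
    exact Submodule.disjoint_def.1 (isCompl_orthCompl N).disjoint t ht
      (cartanSquare_le h (hN ht))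

theorem projection_unique (n : ℕ) (hn : 2 ≤ n)
    (P Q : sl n ⊗[ℂ] sl n →ₗ⁅ℂ, sl n⁆ cartanSquare n hn)
    (hP : ∀ t : cartanSquare n hn, P t = t) (hQ : ∀ t : cartanSquare n hn, Q t = t) : P = Q := by
  have aux : ∀ R : sl n ⊗[ℂ] sl n →ₗ⁅ℂ, sl n⁆ cartanSquare n hn,
      (∀ t : cartanSquare n hn, R t = t) → ∀ t ∈ orthCompl (cartanSquare n hn), R t = 0 := by
    intro R hR t ht
    have h1 : topTensor n hn ∈ orthCompl R.ker := by
      refine (mem_or_mem n hn R.ker).resolve_left fun h => top_ne_zero n hn ?_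
      have h2 := hR ⟨topTensor n hn, top_mem n hn⟩
      rw [LieModuleHom.mem_ker] at h
      exact (congrArg Subtype.val (h2.symm.trans h) :)
    have h3 : (t - (R t).1) ∈ R.ker := by
      rw [LieModuleHom.mem_ker, map_sub, hR, sub_self]
    have h4 : (t - (R t).1) ∈ orthCompl (cartanSquare n hn) := by
      rw [mem_orthCompl]
      intro s hs
      exact inner_eq_zero_symm.1 (mem_orthCompl.1 (cartanSquare_le h1 hs) _ h3)
    have h5 : (R t).1 ∈ orthCompl (cartanSquare n hn) := by
      have := sub_mem ht h4
      rwa [sub_sub_cancel] at this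
    exact Subtype.ext (Submodule.disjoint_def.1
      (isCompl_orthCompl (cartanSquare n hn)).disjoint _ (R t).2 h5)
  ext1 t
  have ht : t ∈ (cartanSquare n hn).toSubmodule ⊔ (orthCompl (cartanSquare n hn)).toSubmodule := by
    rw [(isCompl_orthCompl _).sup_eq_top]; trivial
  obtain ⟨a, ha, b, hb, rfl⟩ := Submodule.mem_sup.1 ht
  rw [map_add, map_add, aux P hP b hb, aux Q hQ b hb, hP ⟨a, ha⟩, hQ ⟨a, ha⟩]

/-- The Cartan square is an irreducible `g`-module. -/
theorem cartanSquare_isIrreducible (n : ℕ) (hn : 2 ≤ n) :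
    LieModule.IsIrreducible ℂ (sl n) (cartanSquare n hn) := by
  have : Nontrivial (cartanSquare n hn) :=
    ⟨⟨topTensor n hn, top_mem n hn⟩, 0, fun h => top_ne_zero n hn (congrArg Subtype.val h)⟩
  refine LieModule.IsIrreducible.mk fun N hN => ?_
  have h1 := eq_cartanSquare_of_le n hn (N.map (cartanSquare n hn).incl)
    LieSubmodule.map_incl_le (by
      intro h
      apply hN
      rw [LieSubmodule.eq_bot_iff] at h ⊢
      intro t ht
      exact Subtype.ext (h t.1 (LieSubmodule.mem_map_of_mem ht)))
  rw [eq_top_iff]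
  intro t _
  obtain ⟨s, hs, hst⟩ := (LieSubmodule.mem_map _).1 (h1.ge t.2)
  have : s = t := Subtype.ext hst
  exact this ▸ hs

end Projection

/-- The invariant projection `X ⊗ Y ↦ X ⊚ Y` of `g ⊗ g` onto the Cartan square of `g = sl(n, ℂ)`:
the unique morphism of `g`-modules `g ⊗ g → ⊚²g` that restricts to the identity on `⊚²g`. -/
noncomputable def cartanProjection (n : ℕ) (hn : 2 ≤ n) :
    sl n ⊗[ℂ] sl n →ₗ⁅ℂ, sl n⁆ cartanSquare n hn :=
  (exists_projection n hn).choose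

theorem cartanProjection_apply (n : ℕ) (hn : 2 ≤ n) (t : cartanSquare n hn) :
    cartanProjection n hn t = t :=
  (exists_projection n hn).choose_spec t

theorem eq_cartanProjection (n : ℕ) (hn : 2 ≤ n)
    (P : sl n ⊗[ℂ] sl n →ₗ⁅ℂ, sl n⁆ cartanSquare n hn) (hP : ∀ t : cartanSquare n hn, P t = t) :
    P = cartanProjection n hn :=
  projection_unique n hn _ _ hP (cartanProjection_apply n hn)

/-- The composition `Φ : Λ²g ⊗ g ↪ g ⊗ g ⊗ g → g ⊗ ⊚²g`, whose second arrow is `Id ⊗ (_ ⊚ _)`. -/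
noncomputable def Phi (n : ℕ) (hn : 2 ≤ n) :
    skewSquare (sl n) ⊗[ℂ] sl n →ₗ⁅ℂ, sl n⁆ sl n ⊗[ℂ] cartanSquare n hn :=
  (TensorProduct.LieModule.map LieModuleHom.id (cartanProjection n hn)).comp
    ((tensorAssoc (sl n)).comp
      (TensorProduct.LieModule.map (skewSquare (sl n)).incl LieModuleHom.id))

end CartanSl

/-! Write g for `sl n`. The trace form identifies g with its dual, so Hom_g(g, g ⊗ M) ≅ Hom_g(g ⊗ g,
M) for every g-module M (`homContract`), and the dimensions concern morphisms out of g ⊗ g.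

For M = ⊚²g: twice the highest root has multiplicity one in g ⊗ g, so a morphism f sends the top
tensor to a multiple c of itself. Then f minus c times the Cartan projection vanishes on ⊚²g, and
uniqueness of the projection makes it zero (`eq_smul_cartanProjection`).

For M = Λ²g: the tensor E_pq ⊗ E_qp of opposite root vectors generates g ⊗ g (`hom_eq_zero`), so a
morphism is determined by its value there. That value, read as a skew form on g, is invariant under
everything that annihilates the tensor, in particular the diagonal matrices and the gl(n-2) block
away from p and q. Such a form depends on four numbers if n ≥ 3 (`skew_form_eq_zero_of_ne`) and on
one if n = 2. The bound is attained for n ≥ 3 by antisymmetrization together with the morphisms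
built from the products XYZ, YXZ and XZY, whose coordinates are triangular; for n = 2
antisymmetrization suffices.

Finally, composition with Φ maps a space of dimension 4 to one of dimension 1, so its kernel, which
is Hom_g(g, ker Φ), has dimension at least 3. -/

namespace CartanSl

/-! ### Elementary matrices: generation by commutators and invariant skew forms -/

section MatrixUnits

variable {ι : Type*} [Fintype ι] [DecidableEq ι]

theorem single_mul_single_eq_ite (i j k l : ι) :
    Matrix.single i j (1 : ℂ) * Matrix.single k l 1 = if j = k then Matrix.single i l 1 else 0 := by
  split_ifs with h
  · subst h; simp
  · exact Matrix.single_mul_single_of_ne _ _ _ _ h _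

theorem sum_single_self : ∑ k : ι, Matrix.single k k (1 : ℂ) = 1 := by
  ext i j
  simp [Matrix.sum_apply, Matrix.single_apply, Matrix.one_apply, ite_and]

theorem eq_top_of_single_mem (S : Submodule ℂ (Matrix ι ι ℂ))
    (h : ∀ i j, Matrix.single i j (1 : ℂ) ∈ S) : S = ⊤ := by
  rw [eq_top_iff]
  intro A _
  rw [Matrix.matrix_eq_sum_single A]
  refine Submodule.sum_mem _ fun i _ => Submodule.sum_mem _ fun j _ => ?_
  have := S.smul_mem (A i j) (h i j)
  rwa [Matrix.smul_single, smul_eq_mul, mul_one] at this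

/-- A subspace of the matrices that contains the identity and the elementary matrix `E_{pq}`, and
is stable under the commutators with all `E_{kl}` that commute with `E_{qp}`, is everything. -/
theorem eq_top_of_commutator_mem {p q : ι} (hpq : p ≠ q) (S : Submodule ℂ (Matrix ι ι ℂ))
    (h1 : 1 ∈ S) (htop : Matrix.single p q 1 ∈ S)
    (hS : ∀ k l, k ≠ p → l ≠ q → ∀ A ∈ S,
      Matrix.single k l 1 * A - A * Matrix.single k l 1 ∈ S) : S = ⊤ := by
  -- Column q comes first, from [E_kp, E_pq] = E_kq. Applying [E_ql, ·] to E_kq then gives -E_kl if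
  -- k ≠ l, and E_qq - E_kk if k = l.
  have hcol : ∀ k, k ≠ q → Matrix.single k q (1 : ℂ) ∈ S := by
    intro k hk
    by_cases hkp : k = p
    · rwa [hkp]
    · have := hS k p hkp hpq _ htop
      simpa [single_mul_single_eq_ite, hk.symm] using this
  have hmid : ∀ k l, k ≠ q → l ≠ q → k ≠ l → Matrix.single k l (1 : ℂ) ∈ S := by
    intro k l hk hl hkl
    have := hS q l hpq.symm hl _ (hcol k hk)
    rw [single_mul_single_eq_ite, single_mul_single_eq_ite, if_neg hkl.symm, if_pos rfl,
      zero_sub] at this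
    simpa using S.neg_mem this
  have hdiag : ∀ k, k ≠ q → Matrix.single q q (1 : ℂ) - Matrix.single k k 1 ∈ S := by
    intro k hk
    have := hS q k hpq.symm hk _ (hcol k hk)
    rwa [single_mul_single_eq_ite, single_mul_single_eq_ite, if_pos rfl, if_pos rfl] at this
  have hrow : ∀ l, l ≠ q → Matrix.single q l (1 : ℂ) ∈ S := by
    intro l hl
    have := hS q l hpq.symm hl _ (hdiag l hl)
    simp only [mul_sub, sub_mul, single_mul_single_eq_ite, if_neg hl, if_pos] at this
    -- [E_ql, E_qq - E_ll] = -2 E_ql.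
    have h2 := S.smul_mem (-(1 / 2) : ℂ) this
    convert h2 using 1
    rw [zero_sub, sub_zero, ← neg_add', smul_neg, neg_smul, neg_neg, ← two_smul ℂ, smul_smul]
    norm_num
  have hqq : Matrix.single q q (1 : ℂ) ∈ S := by
    -- This sum is |ι| E_qq - 1; adding the identity isolates E_qq.
    have hsum : ∑ k : ι, (Matrix.single q q (1 : ℂ) - Matrix.single k k 1) ∈ S := by
      refine Submodule.sum_mem _ fun k _ => ?_
      by_cases hk : k = q
      · rw [hk, sub_self]; exact S.zero_mem
      · exact hdiag k hk
    rw [Finset.sum_sub_distrib, sum_single_self, Finset.sum_const, Finset.card_univ] at hsum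
    have h2 := S.add_mem hsum h1
    rw [sub_add_cancel, ← Nat.cast_smul_eq_nsmul ℂ] at h2
    have hc : (Fintype.card ι : ℂ) ≠ 0 := by
      have : Nonempty ι := ⟨p⟩
      exact_mod_cast Fintype.card_ne_zero
    exact (S.smul_mem_iff hc).1 h2
  refine eq_top_of_single_mem S fun k l => ?_
  by_cases hk : k = q
  · by_cases hl : l = q
    · rwa [hk, hl]
    · rw [hk]; exact hrow l hl
  · by_cases hl : l = q
    · rw [hl]; exact hcol k hk
    · by_cases hkl : k = l
      · subst hkl
        have := S.sub_mem hqq (hdiag k hk)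
        rwa [sub_sub_cancel] at this
      · exact hmid k l hk hl hkl

/-- A skew bilinear form on the matrices that vanishes on the identity and is invariant under the
diagonal matrices and the matrices supported away from the indices `p`, `q`, is determined by its
values on `(E_{pk}, E_{kp})`, `(E_{kq}, E_{qk})`, `(E_{qp}, E_{pq})` and `(E_{pp}, E_{qq})`. -/
theorem skew_form_eq_zero {p q : ι} (hpq : p ≠ q)
    (β : Matrix ι ι ℂ →ₗ[ℂ] Matrix ι ι ℂ →ₗ[ℂ] ℂ) (hskew : ∀ A B, β A B = -β B A)
    (hone : ∀ A, β A 1 = 0)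
    (hinv : ∀ k l, (k = l ∨ k ≠ p ∧ k ≠ q ∧ l ≠ p ∧ l ≠ q) → ∀ A B,
      β (Matrix.single k l 1 * A - A * Matrix.single k l 1) B +
        β A (Matrix.single k l 1 * B - B * Matrix.single k l 1) = 0)
    (hqp : β (Matrix.single q p 1) (Matrix.single p q 1) = 0)
    (hp : ∀ k, k ≠ p → k ≠ q → β (Matrix.single p k 1) (Matrix.single k p 1) = 0)
    (hq : ∀ k, k ≠ p → k ≠ q → β (Matrix.single k q 1) (Matrix.single q k 1) = 0)
    (hd : β (Matrix.single p p 1) (Matrix.single q q 1) = 0) : β = 0 := by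
  have hself : ∀ A, β A A = 0 := fun A => self_eq_neg.1 (hskew A A)
  -- Invariance under the diagonal matrices: only pairs of opposite weight can have a nonzero value.
  -- Testing the weights at E_ii and E_kk is enough.
  have hweight : ∀ i j k l, ¬(i = l ∧ j = k) → ¬(i = j ∧ k = l) →
      β (Matrix.single i j 1) (Matrix.single k l 1) = 0 := by
    intro i j k l h1 h2
    have hw : ∀ m : ι, ((if m = i then 1 else 0) - (if j = m then 1 else 0) +
        (if m = k then 1 else 0) - (if l = m then 1 else 0) : ℂ) *
        β (Matrix.single i j 1) (Matrix.single k l 1) = 0 := by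
      intro m
      have := hinv m m (Or.inl rfl) (Matrix.single i j 1) (Matrix.single k l 1)
      have e1 : ∀ a b : ι, (if m = a then Matrix.single m b (1 : ℂ) else 0) =
          (if m = a then (1 : ℂ) else 0) • Matrix.single a b 1 := by
        intro a b; split_ifs with h <;> simp [h]
      have e2 : ∀ a b : ι, (if b = m then Matrix.single a m (1 : ℂ) else 0) =
          (if b = m then (1 : ℂ) else 0) • Matrix.single a b 1 := by
        intro a b; split_ifs with h <;> simp [h]
      simp only [single_mul_single_eq_ite, e1, e2, map_sub, map_smul, LinearMap.sub_apply,
        LinearMap.smul_apply, smul_eq_mul] at this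
      linear_combination this
    have hi := hw i
    have hk := hw k
    by_contra hne
    replace hi := (mul_eq_zero.1 hi).resolve_right hne
    replace hk := (mul_eq_zero.1 hk).resolve_right hne
    by_cases hij : i = j
    · have hkl : ¬ l = k := fun h => h2 ⟨hij, h.symm⟩
      subst hij
      have hik : ¬ (i = k ∧ i = l) := fun h => hkl (h.2.symm.trans h.1)
      simp only [if_true, if_neg hkl, sub_zero] at hk
      by_cases h : k = i
      · subst h; norm_num at hk
      · rw [if_neg h, if_neg (Ne.symm h)] at hk; norm_num at hk
    · by_cases hil : i = l
      · have hjk : ¬ j = k := fun h => h1 ⟨hil, h⟩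
        subst hil
        simp only [if_true, if_neg hjk] at hk
        by_cases h : k = i
        · subst h; norm_num at hk
        · rw [if_neg h, if_neg (Ne.symm h)] at hk; norm_num at hk
      · simp only [if_true, if_neg (Ne.symm hij), if_neg (Ne.symm hil)] at hi
        by_cases h : i = k
        · rw [if_pos h] at hi; norm_num at hi
        · rw [if_neg h] at hi; norm_num at hi
  -- Invariance under E_kl in the block, evaluated on the pair (H, E_lk).
  have hroot : ∀ k l, k ≠ p → k ≠ q → l ≠ p → l ≠ q → k ≠ l → ∀ H,
      β (Matrix.single k l 1 * H - H * Matrix.single k l 1) (Matrix.single l k 1) +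
      β H (Matrix.single k k 1 - Matrix.single l l 1) = 0 := by
    intro k l h1 h2 h3 h4 h5 H
    have := hinv k l (Or.inr ⟨h1, h2, h3, h4⟩) H (Matrix.single l k 1)
    rwa [single_mul_single_eq_ite, single_mul_single_eq_ite, if_pos rfl, if_pos rfl] at this
  have hlevi : ∀ k l, k ≠ p → k ≠ q → l ≠ p → l ≠ q → k ≠ l →
      β (Matrix.single k l 1) (Matrix.single l k 1) = 0 := by
    intro k l h1 h2 h3 h4 h5
    -- With H = E_kk - E_ll the second term is β(H, H) = 0, and [E_kl, H] = -2 E_kl.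
    have := hroot k l h1 h2 h3 h4 h5 (Matrix.single k k 1 - Matrix.single l l 1)
    rw [hself, add_zero] at this
    simp only [mul_sub, sub_mul, single_mul_single_eq_ite, if_pos, if_neg h5.symm] at this
    rw [zero_sub, sub_zero, ← neg_add', map_neg, map_add, LinearMap.neg_apply,
      LinearMap.add_apply] at this
    linear_combination (-1 / 2 : ℂ) * this
  have hoff : ∀ i j, i ≠ j → β (Matrix.single i j 1) (Matrix.single j i 1) = 0 := by
    intro i j hij
    by_cases hip : i = p
    · subst hip
      by_cases hjq : j = q
      · subst hjq; rw [hskew, hqp, neg_zero]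
      · exact hp j hij.symm hjq
    by_cases hjp : j = p
    · subst hjp
      by_cases hiq : i = q
      · subst hiq; exact hqp
      · rw [hskew, hp i hij hiq, neg_zero]
    by_cases hiq : i = q
    · subst hiq; rw [hskew, hq j hjp hij.symm, neg_zero]
    by_cases hjq : j = q
    · subst hjq; exact hq i hip hij
    exact hlevi i j hip hiq hjp hjq hij
  have hcenter : ∀ i k l, k ≠ p → k ≠ q → l ≠ p → l ≠ q →
      β (Matrix.single i i 1) (Matrix.single k k 1) =
        β (Matrix.single i i 1) (Matrix.single l l 1) := by
    intro i k l h1 h2 h3 h4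
    by_cases hkl : k = l
    · rw [hkl]
    have := hroot k l h1 h2 h3 h4 hkl (Matrix.single i i 1)
    -- The commutator is a multiple of E_kl, on which `hlevi` applies.
    have e : β (Matrix.single k l 1 * Matrix.single i i 1 - Matrix.single i i 1 * Matrix.single k l 1)
        (Matrix.single l k 1) = 0 := by
      rw [single_mul_single_eq_ite, single_mul_single_eq_ite]
      have hkl0 := hlevi k l h1 h2 h3 h4 hkl
      split_ifs with h h' h' <;> subst_vars <;> simp [hkl0]
    rw [e, zero_add, map_sub, sub_eq_zero] at this
    exact this
  have hrowsum : ∀ i, ∑ k, β (Matrix.single i i 1) (Matrix.single k k 1) = 0 := by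
    intro i
    rw [← map_sum, sum_single_self, hone]
  -- In the row of E_ii the entries at p and q vanish, all others agree by `hcenter`, and the total
  -- is β(E_ii, 1) = 0; so the common value is zero.
  have hp0 : ∀ i, (i = p ∨ i = q) → ∀ k, β (Matrix.single i i 1) (Matrix.single k k 1) = 0 := by
    intro i hi k
    have hip : β (Matrix.single i i 1) (Matrix.single p p 1) = 0 := by
      rcases hi with rfl | rfl
      · exact hself _
      · rw [hskew, hd, neg_zero]
    have hiq : β (Matrix.single i i 1) (Matrix.single q q 1) = 0 := by
      rcases hi with rfl | rfl
      · exact hd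
      · exact hself _
    by_cases hkp : k = p
    · rw [hkp, hip]
    by_cases hkq : k = q
    · rw [hkq, hiq]
    have hs := hrowsum i
    have e : ∀ j, β (Matrix.single i i 1) (Matrix.single j j 1) =
        if j ∈ Finset.univ.filter (fun j => j ≠ p ∧ j ≠ q) then
          β (Matrix.single i i 1) (Matrix.single k k 1) else 0 := by
      intro j
      split_ifs with h
      · simp only [Finset.mem_filter, Finset.mem_univ, true_and] at h
        exact hcenter i j k h.1 h.2 hkp hkq
      · simp only [Finset.mem_filter, Finset.mem_univ, true_and, not_and_or, not_not] at h
        rcases h with rfl | rfl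
        · exact hip
        · exact hiq
    rw [Finset.sum_congr rfl fun j _ => e j, Finset.sum_ite_mem, Finset.univ_inter,
      Finset.sum_const, nsmul_eq_mul] at hs
    refine (mul_eq_zero.1 hs).resolve_left ?_
    exact Nat.cast_ne_zero.2 (Finset.card_ne_zero.2 ⟨k, by simp [hkp, hkq]⟩)
  have hcartan : ∀ i k, β (Matrix.single i i 1) (Matrix.single k k 1) = 0 := by
    intro i k
    by_cases hi : i = p ∨ i = q
    · exact hp0 i hi k
    by_cases hk : k = p ∨ k = q
    · rw [hskew, hp0 k hk i, neg_zero]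
    push Not at hi hk
    rw [hcenter i k i hk.1 hk.2 hi.1 hi.2, hself]
  have hall : ∀ i j k l, β (Matrix.single i j 1) (Matrix.single k l 1) = 0 := by
    intro i j k l
    by_cases h1 : i = l ∧ j = k
    · obtain ⟨rfl, rfl⟩ := h1
      by_cases hij : i = j
      · subst hij; exact hself _
      · exact hoff i j hij
    by_cases h2 : i = j ∧ k = l
    · obtain ⟨rfl, rfl⟩ := h2
      exact hcartan i k
    exact hweight i j k l h1 h2
  have h2 : ∀ i j, β (Matrix.single i j 1) = 0 := by
    intro i j
    have := eq_top_of_single_mem (LinearMap.ker (β (Matrix.single i j 1))) (hall i j)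
    exact LinearMap.ker_eq_top.1 this
  exact LinearMap.ker_eq_top.1 (eq_top_of_single_mem (LinearMap.ker β) h2)

/-- If there is an index `r` other than `p` and `q`, four values determine the form. -/
theorem skew_form_eq_zero_of_ne {p q r : ι} (hpq : p ≠ q) (hrp : r ≠ p) (hrq : r ≠ q)
    (β : Matrix ι ι ℂ →ₗ[ℂ] Matrix ι ι ℂ →ₗ[ℂ] ℂ) (hskew : ∀ A B, β A B = -β B A)
    (hone : ∀ A, β A 1 = 0)
    (hinv : ∀ k l, (k = l ∨ k ≠ p ∧ k ≠ q ∧ l ≠ p ∧ l ≠ q) → ∀ A B,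
      β (Matrix.single k l 1 * A - A * Matrix.single k l 1) B +
        β A (Matrix.single k l 1 * B - B * Matrix.single k l 1) = 0)
    (hqp : β (Matrix.single q p 1) (Matrix.single p q 1) = 0)
    (hp : β (Matrix.single p r 1) (Matrix.single r p 1) = 0)
    (hq : β (Matrix.single r q 1) (Matrix.single q r 1) = 0)
    (hd : β (Matrix.single p p 1) (Matrix.single q q 1) = 0) : β = 0 := by
  refine skew_form_eq_zero hpq β hskew hone hinv hqp (fun k hkp hkq => ?_)
    (fun k hkp hkq => ?_) hd
  -- E_rk in the block moves the index k to r: [E_rk, E_pr] = -E_pk and [E_rk, E_kp] = E_rp.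
  · have := hinv r k (Or.inr ⟨hrp, hrq, hkp, hkq⟩) (Matrix.single p r 1) (Matrix.single k p 1)
    simpa [single_mul_single_eq_ite, hkp, hrp.symm, hp] using this
  · have := hinv r k (Or.inr ⟨hrp, hrq, hkp, hkq⟩) (Matrix.single k q 1) (Matrix.single q r 1)
    simpa [single_mul_single_eq_ite, hkq, hrq.symm, hq] using this

end MatrixUnits

/-! ### Lie module isomorphisms and postcomposition -/

section Contraction

variable {L : Type*} [LieRing L] [LieAlgebra ℂ L]
variable {V M N : Type*}
  [AddCommGroup V] [Module ℂ V] [LieRingModule L V] [LieModule ℂ L V]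
  [AddCommGroup M] [Module ℂ M] [LieRingModule L M] [LieModule ℂ L M]
  [AddCommGroup N] [Module ℂ N] [LieRingModule L N] [LieModule ℂ L N]

/-- The tensor flip, as an isomorphism of Lie modules. -/
noncomputable def tensorComm : M ⊗[ℂ] N ≃ₗ⁅ℂ, L⁆ N ⊗[ℂ] M :=
  { TensorProduct.comm ℂ M N with
    map_lie' := by
      intro x t
      change TensorProduct.comm ℂ M N ⁅x, t⁆ = ⁅x, TensorProduct.comm ℂ M N t⁆
      induction t using TensorProduct.induction_on with
      | zero => simp
      | tmul a b => simp [add_comm]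
      | add a b ha hb => simp only [lie_add, map_add, ha, hb] }

/-- Postcomposition, as a linear map between spaces of morphisms of Lie modules. -/
def postcomp (f : M →ₗ⁅ℂ, L⁆ N) : (V →ₗ⁅ℂ, L⁆ M) →ₗ[ℂ] (V →ₗ⁅ℂ, L⁆ N) where
  toFun g := f.comp g
  map_add' g h := by ext; simp
  map_smul' c g := by ext; simp

/-- Postcomposition with an isomorphism of Lie modules. -/
def postcompEquiv (e : M ≃ₗ⁅ℂ, L⁆ N) : (V →ₗ⁅ℂ, L⁆ M) ≃ₗ[ℂ] (V →ₗ⁅ℂ, L⁆ N) :=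
  { postcomp e.toLieModuleHom with
    invFun := fun g => e.symm.toLieModuleHom.comp g
    left_inv := fun g => by ext v; exact e.symm_apply_apply (g v)
    right_inv := fun g => by ext v; exact e.apply_symm_apply (g v) }

end Contraction

/-! ### Traceless parts, the trace form, and morphisms out of g ⊗ g -/

section SpecialLinear

attribute [local instance 100] LieRing.ofAssociativeRing

variable {n : ℕ}

/-- The projection of a matrix to its traceless part. -/
noncomputable def toSl (n : ℕ) : Matrix (Fin n) (Fin n) ℂ →ₗ[ℂ] sl n :=
  LinearMap.codRestrict (sl n).toSubmodule
    (LinearMap.id - (Matrix.traceLinearMap (Fin n) ℂ ℂ).smulRight ((n : ℂ)⁻¹ • 1)) (by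
      intro A
      change Matrix.trace (A - A.trace • ((n : ℂ)⁻¹ • (1 : Matrix (Fin n) (Fin n) ℂ))) = 0
      rcases Nat.eq_zero_or_pos n with rfl | h
      · simp [Matrix.trace]
      · have : (n : ℂ) ≠ 0 := Nat.cast_ne_zero.2 h.ne'
        simp [Matrix.trace_sub, Matrix.trace_smul, this])

theorem toSl_val (A : Matrix (Fin n) (Fin n) ℂ) :
    (toSl n A).1 = A - A.trace • ((n : ℂ)⁻¹ • (1 : Matrix (Fin n) (Fin n) ℂ)) := rfl

theorem trace_val (x : sl n) : x.1.trace = 0 := x.2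

theorem toSl_coe (x : sl n) : toSl n x.1 = x :=
  Subtype.ext (by rw [toSl_val, trace_val, zero_smul, sub_zero])

/-- Forms and maps on g, pulled back to all matrices along `toSl`, therefore kill the identity, as
the matrix lemmas require. -/
theorem toSl_one : toSl n 1 = 0 := by
  rcases Nat.eq_zero_or_pos n with rfl | h
  · exact Subtype.ext (Subsingleton.elim _ _)
  · have : (n : ℂ) ≠ 0 := Nat.cast_ne_zero.2 h.ne'
    exact Subtype.ext (by rw [toSl_val]; simp [this])

theorem lie_toSl (P : Matrix (Fin n) (Fin n) ℂ) (x : sl n) :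
    ⁅toSl n P, x⁆ = toSl n (P * x.1 - x.1 * P) := by
  apply Subtype.ext
  rw [LieAlgebra.SpecialLinear.sl_bracket, toSl_val, toSl_val, Matrix.trace_sub,
    Matrix.trace_mul_comm, sub_self, zero_smul, sub_zero]
  simp [sub_mul, mul_sub]

theorem lie_toSl_toSl (P A : Matrix (Fin n) (Fin n) ℂ) :
    ⁅toSl n P, toSl n A⁆ = toSl n (P * A - A * P) := by
  rw [lie_toSl, toSl_val]
  simp [sub_mul, mul_sub]

theorem lie_toSl_right (x : sl n) (A : Matrix (Fin n) (Fin n) ℂ) :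
    ⁅x, toSl n A⁆ = toSl n (x.1 * A - A * x.1) := by
  rw [← lie_toSl_toSl, toSl_coe]

/-- The trace form on `sl(n, ℂ)`, as a map to the dual. -/
noncomputable def traceDual (n : ℕ) : sl n →ₗ[ℂ] Dual ℂ (sl n) :=
  LinearMap.mk₂ ℂ (fun X Y : sl n => (X.1 * Y.1).trace)
    (fun X X' Y => by
      change ((X.1 + X'.1) * Y.1).trace = _
      rw [add_mul, Matrix.trace_add])
    (fun c X Y => by
      change ((c • X.1) * Y.1).trace = _
      rw [smul_mul_assoc, Matrix.trace_smul])
    (fun X Y Y' => by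
      change (X.1 * (Y.1 + Y'.1)).trace = _
      rw [mul_add, Matrix.trace_add])
    (fun c X Y => by
      change (X.1 * (c • Y.1)).trace = _
      rw [mul_smul_comm, Matrix.trace_smul])

theorem traceDual_apply (X Y : sl n) : traceDual n X Y = (X.1 * Y.1).trace := rfl

theorem traceDual_lie (x X Y : sl n) : traceDual n ⁅x, X⁆ Y = -traceDual n X ⁅x, Y⁆ := by
  rw [traceDual_apply, traceDual_apply, LieAlgebra.SpecialLinear.sl_bracket,
    LieAlgebra.SpecialLinear.sl_bracket]
  simp only [mul_sub, sub_mul, Matrix.trace_sub, Matrix.mul_assoc]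
  rw [Matrix.trace_mul_comm x.1, Matrix.mul_assoc]
  ring

open scoped ComplexOrder in
-- Pair X with its conjugate transpose: tr(X X*) = 0 forces X = 0.
theorem traceDual_injective : Function.Injective (traceDual n) := by
  rw [injective_iff_map_eq_zero]
  intro X hX
  have := LinearMap.congr_fun hX (adj X)
  rw [traceDual_apply] at this
  exact Subtype.ext (Matrix.trace_mul_conjTranspose_self_eq_zero_iff.1 this)

/-- The trace form on `sl(n, ℂ)`, as an isomorphism to the dual. -/
noncomputable def traceDualEquiv (n : ℕ) : sl n ≃ₗ[ℂ] Dual ℂ (sl n) :=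
  LinearEquiv.ofInjectiveOfFinrankEq (traceDual n) traceDual_injective
    Subspace.dual_finrank_eq.symm

variable {M : Type*} [AddCommGroup M] [Module ℂ M] [LieRingModule (sl n) M]
  [LieModule ℂ (sl n) M]

variable (M) in
/-- Contraction with the trace form, as a linear isomorphism. -/
noncomputable def contractLinear : sl n ⊗[ℂ] M ≃ₗ[ℂ] (sl n →ₗ[ℂ] M) :=
  (TensorProduct.congr (traceDualEquiv n) (LinearEquiv.refl ℂ M)).trans
    (dualTensorHomEquiv ℂ (sl n) M)

omit [LieRingModule (sl n) M] [LieModule ℂ (sl n) M] in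
theorem contractLinear_tmul (X : sl n) (m : M) (Y : sl n) :
    contractLinear M (X ⊗ₜ m) Y = traceDual n X Y • m := by
  simp only [contractLinear, LinearEquiv.trans_apply, TensorProduct.congr_tmul,
    dualTensorHomEquiv, LinearEquiv.ofBijective_apply, dualTensorHom_apply]
  rfl

variable (M) in
/-- Contraction with the trace form, as an isomorphism of modules from `g ⊗ M` to `Hom(g, M)`. -/
noncomputable def contract : sl n ⊗[ℂ] M ≃ₗ⁅ℂ, sl n⁆ (sl n →ₗ[ℂ] M) :=
  { contractLinear M with
    map_lie' := by
      intro x t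
      change contractLinear M ⁅x, t⁆ = ⁅x, contractLinear M t⁆
      induction t using TensorProduct.induction_on with
      | zero => simp
      | add a b ha hb => simp only [lie_add, map_add, ha, hb]
      | tmul X m =>
        ext1 Y
        simp only [TensorProduct.LieModule.lie_tmul_right, map_add, LinearMap.add_apply,
          contractLinear_tmul, LieHom.lie_apply, lie_smul, traceDual_lie, neg_smul]
        abel }

theorem contract_tmul (X : sl n) (m : M) (Y : sl n) :
    contract M (X ⊗ₜ m) Y = traceDual n X Y • m :=
  contractLinear_tmul X m Y

variable (M) in
/-- `Hom_g(g, g ⊗ M) ≃ Hom_g(g ⊗ g, M)`. -/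
noncomputable def homContract :
    (sl n →ₗ⁅ℂ, sl n⁆ sl n ⊗[ℂ] M) ≃ₗ[ℂ] (sl n ⊗[ℂ] sl n →ₗ⁅ℂ, sl n⁆ M) :=
  (postcompEquiv (contract M)).trans (TensorProduct.LieModule.liftLie ℂ (sl n) (sl n) (sl n) M)

omit [LieModule ℂ (sl n) M] in
/-- A morphism on `g ⊗ g` is determined by its value on the tensor product of a highest root vector
and a lowest root vector. -/
theorem hom_eq_zero {p q : Fin n} (hpq : p ≠ q) (f : sl n ⊗[ℂ] sl n →ₗ⁅ℂ, sl n⁆ M)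
    (hf : f (toSl n (Matrix.single p q 1) ⊗ₜ toSl n (Matrix.single q p 1)) = 0) : f = 0 := by
  let k : Matrix (Fin n) (Fin n) ℂ →ₗ[ℂ] Matrix (Fin n) (Fin n) ℂ →ₗ[ℂ] M :=
    (TensorProduct.mk ℂ (sl n) (sl n)).compl₁₂ (toSl n) (toSl n) |>.compr₂ f.toLinearMap
  have hk : ∀ A B, k A B = f (toSl n A ⊗ₜ toSl n B) := fun A B => rfl
  have hkl : ∀ P A B, k (P * A - A * P) B + k A (P * B - B * P) = ⁅toSl n P, k A B⁆ := by
    intro P A B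
    rw [hk, hk, hk, ← LieModuleHom.map_lie, TensorProduct.LieModule.lie_tmul_right, map_add,
      lie_toSl_toSl, lie_toSl_toSl]
  -- With the second factor fixed at E_qp, a matrix commuting with E_qp acts through the first
  -- factor only, so the set of A with f(A ⊗ E_qp) = 0 is stable under its commutators.
  have h1 : LinearMap.ker (k.flip (Matrix.single q p 1)) = ⊤ := by
    refine eq_top_of_commutator_mem hpq _ ?_ hf fun i j hi hj A hA => ?_
    · simp [hk, toSl_one]
    · have := hkl (Matrix.single i j 1) A (Matrix.single q p 1)
      rw [LinearMap.mem_ker, LinearMap.flip_apply] at hA ⊢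
      rw [hA, lie_zero, single_mul_single_eq_ite, single_mul_single_eq_ite, if_neg hj,
        if_neg hi.symm, sub_zero, map_zero, add_zero] at this
      exact this
  -- The set of B with f(A ⊗ B) = 0 for every A is stable under all commutators and contains E_qp by
  -- `h1`.
  have h2 : LinearMap.ker k.flip = ⊤ := by
    refine eq_top_of_commutator_mem hpq.symm _ ?_ (LinearMap.ker_eq_top.1 h1)
      fun i j hi hj B hB => ?_
    · ext A; simp [hk, toSl_one]
    · rw [LinearMap.mem_ker] at hB ⊢
      ext1 A
      have h3 : ∀ C, k C B = 0 := fun C => LinearMap.congr_fun hB C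
      have := hkl (Matrix.single i j 1) A B
      rw [h3, h3, lie_zero, zero_add] at this
      exact this
  ext t
  induction t using TensorProduct.induction_on with
  | zero => simp
  | add a b ha hb => rw [map_add, ha, hb]; simp
  | tmul X Y =>
    have : k X.1 Y.1 = 0 := by
      have := LinearMap.congr_fun (LinearMap.congr_fun (LinearMap.ker_eq_top.1 h2) Y.1) X.1
      exact this
    rwa [hk, toSl_coe, toSl_coe] at this

/-- `Hom_g(g ⊗ g, ⊚²g)` is spanned by the Cartan projection. -/
theorem eq_smul_cartanProjection (hn : 2 ≤ n)
    (f : sl n ⊗[ℂ] sl n →ₗ⁅ℂ, sl n⁆ cartanSquare n hn) :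
    ∃ c : ℂ, c • cartanProjection n hn = f := by
  have hw : ⁅coroot n hn, (f (topTensor n hn)).1⁆ = (4 : ℂ) • (f (topTensor n hn)).1 := by
    have : ⁅coroot n hn, f (topTensor n hn)⁆ = (4 : ℂ) • f (topTensor n hn) := by
      rw [← LieModuleHom.map_lie, lie_coroot_top, map_smul]
    exact congrArg Subtype.val this
  obtain ⟨c, hc⟩ := eq_smul_top n hn _ hw
  refine ⟨c, ?_⟩
  have hP := cartanProjection_apply n hn ⟨topTensor n hn, top_mem n hn⟩
  let g := f - c • cartanProjection n hn
  have htop : topTensor n hn ∈ g.ker := by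
    rw [LieModuleHom.mem_ker]
    change f (topTensor n hn) - c • cartanProjection n hn (topTensor n hn) = 0
    rw [hP, sub_eq_zero]
    exact Subtype.ext hc
  have hg : ∀ t : cartanSquare n hn, g t = 0 := fun t =>
    LieModuleHom.mem_ker.1 (cartanSquare_le htop t.2)
  -- Since g vanishes on ⊚²g, adding it to the projection gives another projection; uniqueness gives
  -- g = 0.
  have h := eq_cartanProjection n hn (g + cartanProjection n hn) fun t => by
    rw [LieModuleHom.add_apply, hg, zero_add, cartanProjection_apply]
  have hg0 : g = 0 := add_eq_right.1 h
  exact (sub_eq_zero.1 hg0).symm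

theorem finrank_hom_cartanSquare (hn : 2 ≤ n) :
    finrank ℂ (sl n →ₗ⁅ℂ, sl n⁆ sl n ⊗[ℂ] cartanSquare n hn) = 1 := by
  rw [(homContract (cartanSquare n hn)).finrank_eq, finrank_eq_one_iff']
  refine ⟨cartanProjection n hn, fun h => top_ne_zero n hn ?_, eq_smul_cartanProjection hn⟩
  have hP := cartanProjection_apply n hn ⟨topTensor n hn, top_mem n hn⟩
  rw [h] at hP
  exact (congrArg Subtype.val hP).symm

end SpecialLinear

/-! ### Antisymmetrization -/

section SkewSquare

variable {L : Type*} [LieRing L] [LieAlgebra ℂ L]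

theorem mem_skewSquare {t : L ⊗[ℂ] L} :
    t ∈ skewSquare L ↔ TensorProduct.comm ℂ L L t = -t := Iff.rfl

/-- The antisymmetrization `t ↦ t - tᵒᵖ`. -/
noncomputable def antisymmetrize : L ⊗[ℂ] L →ₗ⁅ℂ, L⁆ skewSquare L :=
  (LieModuleHom.id - (tensorComm : L ⊗[ℂ] L ≃ₗ⁅ℂ, L⁆ L ⊗[ℂ] L).toLieModuleHom).codRestrict
    (skewSquare L) (by
      intro t
      rw [mem_skewSquare]
      change TensorProduct.comm ℂ L L (t - TensorProduct.comm ℂ L L t) =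
        -(t - TensorProduct.comm ℂ L L t)
      rw [map_sub, TensorProduct.comm_comm, neg_sub])

theorem antisymmetrize_val (t : L ⊗[ℂ] L) :
    (antisymmetrize t).1 = t - TensorProduct.comm ℂ L L t := rfl

end SkewSquare

/-! ### Morphisms g ⊗ g → Λ²g as invariant skew forms -/

section SpecialLinear

attribute [local instance 100] LieRing.ofAssociativeRing

variable {n : ℕ}

/-- A tensor in `g ⊗ g`, as a bilinear form on `g`. -/
noncomputable def toForm (n : ℕ) : sl n ⊗[ℂ] sl n →ₗ[ℂ] sl n →ₗ[ℂ] sl n →ₗ[ℂ] ℂ where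
  toFun t := (traceDual n).comp (contract (sl n) t)
  map_add' s t := by rw [map_add, LinearMap.comp_add]
  map_smul' c t := by rw [map_smul, LinearMap.comp_smul, RingHom.id_apply]

theorem toForm_apply (t : sl n ⊗[ℂ] sl n) (A B : sl n) :
    toForm n t A B = traceDual n (contract (sl n) t A) B := rfl

theorem toForm_tmul (X Y A B : sl n) :
    toForm n (X ⊗ₜ Y) A B = traceDual n X A * traceDual n Y B := by
  rw [toForm_apply, contract_tmul, map_smul]
  rfl

theorem toForm_injective : Function.Injective (toForm n) := by
  rw [injective_iff_map_eq_zero]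
  intro t ht
  apply (contract (sl n)).injective
  rw [map_zero]
  ext1 A
  apply traceDual_injective
  rw [LinearMap.zero_apply, map_zero]
  exact LinearMap.congr_fun ht A

theorem toForm_comm (t : sl n ⊗[ℂ] sl n) (A B : sl n) :
    toForm n (TensorProduct.comm ℂ _ _ t) A B = toForm n t B A := by
  induction t using TensorProduct.induction_on with
  | zero => simp
  | add a b ha hb => simp only [map_add, LinearMap.add_apply, ha, hb]
  | tmul X Y => rw [TensorProduct.comm_tmul, toForm_tmul, toForm_tmul, mul_comm]

theorem toForm_lie (x : sl n) (t : sl n ⊗[ℂ] sl n) (A B : sl n) :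
    toForm n ⁅x, t⁆ A B = -(toForm n t ⁅x, A⁆ B + toForm n t A ⁅x, B⁆) := by
  have h : contract (sl n) ⁅x, t⁆ = ⁅x, contract (sl n) t⁆ :=
    LieModuleHom.map_lie (contract (sl n)).toLieModuleHom x t
  rw [toForm_apply, h, LieHom.lie_apply, map_sub, LinearMap.sub_apply,
    traceDual_lie, toForm_apply, toForm_apply]
  ring

theorem toForm_antisymmetrize (t : sl n ⊗[ℂ] sl n) (A B : sl n) :
    toForm n (antisymmetrize t).1 A B = toForm n t A B - toForm n t B A := by
  rw [antisymmetrize_val, map_sub, LinearMap.sub_apply, LinearMap.sub_apply, toForm_comm]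

/-- The value of a morphism `g ⊗ g → Λ²g` at `E_{pq} ⊗ E_{qp}`, as a form on the matrices. -/
noncomputable def skewValue (p q : Fin n) :
    (sl n ⊗[ℂ] sl n →ₗ⁅ℂ, sl n⁆ skewSquare (sl n)) →ₗ[ℂ]
      Matrix (Fin n) (Fin n) ℂ →ₗ[ℂ] Matrix (Fin n) (Fin n) ℂ →ₗ[ℂ] ℂ where
  toFun h := (toForm n (h (toSl n (Matrix.single p q 1) ⊗ₜ
    toSl n (Matrix.single q p 1))).1).compl₁₂ (toSl n) (toSl n)
  map_add' g h := by
    ext A B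
    exact LinearMap.congr_fun₂ (map_add (toForm n) (g _).1 (h _).1) _ _
  map_smul' c h := by
    ext A B
    exact LinearMap.congr_fun₂ (map_smul (toForm n) c (h _).1) _ _

theorem skewValue_apply (p q : Fin n) (h : sl n ⊗[ℂ] sl n →ₗ⁅ℂ, sl n⁆ skewSquare (sl n))
    (A B : Matrix (Fin n) (Fin n) ℂ) :
    skewValue p q h A B = toForm n (h (toSl n (Matrix.single p q 1) ⊗ₜ
      toSl n (Matrix.single q p 1))).1 (toSl n A) (toSl n B) := rfl

theorem eq_zero_of_skewValue_eq_zero {p q : Fin n} (hpq : p ≠ q)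
    (h : sl n ⊗[ℂ] sl n →ₗ⁅ℂ, sl n⁆ skewSquare (sl n)) (h0 : skewValue p q h = 0) : h = 0 := by
  refine hom_eq_zero hpq h (Subtype.ext (toForm_injective ?_))
  ext A B
  have := LinearMap.congr_fun (LinearMap.congr_fun h0 A.1) B.1
  rw [skewValue_apply, toSl_coe, toSl_coe] at this
  rw [this]
  simp

theorem skewValue_skew (p q : Fin n) (h : sl n ⊗[ℂ] sl n →ₗ⁅ℂ, sl n⁆ skewSquare (sl n))
    (A B : Matrix (Fin n) (Fin n) ℂ) : skewValue p q h A B = -skewValue p q h B A := by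
  rw [skewValue_apply, skewValue_apply, ← toForm_comm, mem_skewSquare.1 (Subtype.prop _)]
  simp

theorem skewValue_one (p q : Fin n) (h : sl n ⊗[ℂ] sl n →ₗ⁅ℂ, sl n⁆ skewSquare (sl n))
    (A : Matrix (Fin n) (Fin n) ℂ) : skewValue p q h A 1 = 0 := by
  rw [skewValue_apply, toSl_one, map_zero]

/-- The two factors have opposite weights, which cancel under diagonal matrices; the block away from
p and q commutes with both. -/
theorem lie_tmul_root_eq_zero {p q k l : Fin n} (hpq : p ≠ q)
    (hkl : k = l ∨ k ≠ p ∧ k ≠ q ∧ l ≠ p ∧ l ≠ q) :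
    ⁅toSl n (Matrix.single k l 1),
      toSl n (Matrix.single p q 1) ⊗ₜ[ℂ] toSl n (Matrix.single q p 1)⁆ = 0 := by
  rw [TensorProduct.LieModule.lie_tmul_right, lie_toSl_toSl, lie_toSl_toSl]
  simp only [single_mul_single_eq_ite]
  rcases hkl with rfl | ⟨h1, h2, h3, h4⟩
  · by_cases hp : k = p
    · subst hp
      simp [hpq, hpq.symm, TensorProduct.tmul_neg]
    by_cases hq : k = q
    · subst hq
      simp [hpq, hpq.symm, TensorProduct.neg_tmul]
    simp [hp, hq, Ne.symm hp, Ne.symm hq]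
  · simp [h3, h4, h1.symm, h2.symm]

theorem skewValue_invariant {p q : Fin n} (hpq : p ≠ q)
    (h : sl n ⊗[ℂ] sl n →ₗ⁅ℂ, sl n⁆ skewSquare (sl n)) (k l : Fin n)
    (hkl : k = l ∨ k ≠ p ∧ k ≠ q ∧ l ≠ p ∧ l ≠ q) (A B : Matrix (Fin n) (Fin n) ℂ) :
    skewValue p q h (Matrix.single k l 1 * A - A * Matrix.single k l 1) B +
      skewValue p q h A (Matrix.single k l 1 * B - B * Matrix.single k l 1) = 0 := by
  rw [skewValue_apply, skewValue_apply, ← lie_toSl_toSl, ← lie_toSl_toSl]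
  refine neg_eq_zero.1 ?_
  rw [← toForm_lie, ← LieSubmodule.coe_bracket, ← LieModuleHom.map_lie,
    lie_tmul_root_eq_zero hpq hkl]
  simp

/-- The bilinear map `g × g → Hom(g, g)` obtained from a trilinear map on matrices by projecting its
values to their traceless part. -/
noncomputable def trilinear (m : Matrix (Fin n) (Fin n) ℂ →ₗ[ℂ] Matrix (Fin n) (Fin n) ℂ →ₗ[ℂ]
    Matrix (Fin n) (Fin n) ℂ →ₗ[ℂ] Matrix (Fin n) (Fin n) ℂ) :
    sl n →ₗ[ℂ] sl n →ₗ[ℂ] sl n →ₗ[ℂ] sl n :=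
  LinearMap.mk₂ ℂ (fun X Y : sl n => toSl n ∘ₗ m X.1 Y.1 ∘ₗ (sl n).toSubmodule.subtype)
    (fun X X' Y => by ext1; simp)
    (fun c X Y => by ext1; simp)
    (fun X Y Y' => by ext1; simp)
    (fun c X Y => by ext1; simp)

theorem trilinear_apply (m : Matrix (Fin n) (Fin n) ℂ →ₗ[ℂ] Matrix (Fin n) (Fin n) ℂ →ₗ[ℂ]
    Matrix (Fin n) (Fin n) ℂ →ₗ[ℂ] Matrix (Fin n) (Fin n) ℂ) (X Y Z : sl n) :
    trilinear m X Y Z = toSl n (m X.1 Y.1 Z.1) := rfl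

/-- The morphism `g ⊗ g → Hom(g, g)` obtained from an equivariant trilinear map on matrices. -/
noncomputable def trilinearHom (m : Matrix (Fin n) (Fin n) ℂ →ₗ[ℂ] Matrix (Fin n) (Fin n) ℂ →ₗ[ℂ]
    Matrix (Fin n) (Fin n) ℂ →ₗ[ℂ] Matrix (Fin n) (Fin n) ℂ)
    (hm : ∀ P X Y Z, m (P * X - X * P) Y Z + m X (P * Y - Y * P) Z + m X Y (P * Z - Z * P) =
      P * m X Y Z - m X Y Z * P) : sl n ⊗[ℂ] sl n →ₗ⁅ℂ, sl n⁆ sl n →ₗ[ℂ] sl n :=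
  { TensorProduct.lift (trilinear m) with
    map_lie' := by
      intro x t
      change TensorProduct.lift (trilinear m) ⁅x, t⁆ = ⁅x, TensorProduct.lift (trilinear m) t⁆
      induction t using TensorProduct.induction_on with
      | zero => simp
      | add a b ha hb => simp only [lie_add, map_add, ha, hb]
      | tmul X Y =>
        ext1 Z
        simp only [TensorProduct.LieModule.lie_tmul_right, map_add, LinearMap.add_apply,
          TensorProduct.lift.tmul, LieHom.lie_apply, trilinear_apply, lie_toSl_right,
          LieAlgebra.SpecialLinear.sl_bracket]
        -- The action on Hom(g, g) subtracts the term with [x, Z], which is the third term of the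
        -- equivariance of m.
        rw [← hm, ← map_add, ← map_sub, add_sub_cancel_right] }

/-- The morphism `g ⊗ g → Λ²g` obtained from an equivariant trilinear map on matrices. -/
noncomputable def trilinearSkew (m : Matrix (Fin n) (Fin n) ℂ →ₗ[ℂ]
    Matrix (Fin n) (Fin n) ℂ →ₗ[ℂ] Matrix (Fin n) (Fin n) ℂ →ₗ[ℂ] Matrix (Fin n) (Fin n) ℂ)
    (hm : ∀ P X Y Z, m (P * X - X * P) Y Z + m X (P * Y - Y * P) Z + m X Y (P * Z - Z * P) =
      P * m X Y Z - m X Y Z * P) : sl n ⊗[ℂ] sl n →ₗ⁅ℂ, sl n⁆ skewSquare (sl n) :=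
  antisymmetrize.comp ((contract (sl n)).symm.toLieModuleHom.comp (trilinearHom m hm))

/-- Scalar matrices are orthogonal to traceless ones, so the projection does not change the pairing.
-/
theorem traceDual_toSl (W : Matrix (Fin n) (Fin n) ℂ) (B : sl n) :
    traceDual n (toSl n W) B = (W * B.1).trace := by
  rw [traceDual_apply, toSl_val, sub_mul, Matrix.trace_sub, smul_mul_assoc, smul_mul_assoc,
    one_mul, Matrix.trace_smul, Matrix.trace_smul, trace_val]
  simp

theorem toSl_val_of_trace {A : Matrix (Fin n) (Fin n) ℂ} (h : A.trace = 0) : (toSl n A).1 = A := by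
  rw [toSl_val, h, zero_smul, sub_zero]

theorem toSl_single_val {i j : Fin n} (h : i ≠ j) :
    (toSl n (Matrix.single i j 1)).1 = Matrix.single i j 1 :=
  toSl_val_of_trace (Matrix.trace_single_eq_of_ne i j 1 h)

theorem skewValue_trilinearSkew {p q : Fin n} (hpq : p ≠ q)
    (m : Matrix (Fin n) (Fin n) ℂ →ₗ[ℂ]
      Matrix (Fin n) (Fin n) ℂ →ₗ[ℂ] Matrix (Fin n) (Fin n) ℂ →ₗ[ℂ] Matrix (Fin n) (Fin n) ℂ)
    (hm : ∀ P X Y Z, m (P * X - X * P) Y Z + m X (P * Y - Y * P) Z + m X Y (P * Z - Z * P) =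
      P * m X Y Z - m X Y Z * P) (A B : Matrix (Fin n) (Fin n) ℂ) :
    skewValue p q (trilinearSkew m hm) A B =
      (m (Matrix.single p q 1) (Matrix.single q p 1) (toSl n A).1 * (toSl n B).1).trace -
      (m (Matrix.single p q 1) (Matrix.single q p 1) (toSl n B).1 * (toSl n A).1).trace := by
  have key : ∀ t A B, toForm n ((contract (sl n)).symm (trilinearHom m hm t)) A B =
      traceDual n (trilinearHom m hm t A) B := by
    intro t A B
    rw [toForm_apply, LieModuleEquiv.apply_symm_apply]
  rw [skewValue_apply]
  refine (toForm_antisymmetrize _ _ _).trans ?_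
  refine congrArg₂ (· - ·) ((key _ _ _).trans ?_) ((key _ _ _).trans ?_)
  · refine (traceDual_toSl _ _).trans ?_
    simp only [LinearMap.coe_comp, Function.comp_apply, toSl_single_val hpq,
      toSl_single_val hpq.symm]
    rfl
  · refine (traceDual_toSl _ _).trans ?_
    simp only [LinearMap.coe_comp, Function.comp_apply, toSl_single_val hpq,
      toSl_single_val hpq.symm]
    rfl

theorem skewValue_antisymmetrize {p q : Fin n} (hpq : p ≠ q) (A B : Matrix (Fin n) (Fin n) ℂ) :
    skewValue p q antisymmetrize A B =
      (Matrix.single p q 1 * (toSl n A).1).trace * (Matrix.single q p 1 * (toSl n B).1).trace -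
      (Matrix.single p q 1 * (toSl n B).1).trace * (Matrix.single q p 1 * (toSl n A).1).trace := by
  rw [skewValue_apply, toForm_antisymmetrize]
  simp only [toForm_tmul, traceDual_apply, toSl_single_val hpq, toSl_single_val hpq.symm]

/-! ### Explicit morphisms from matrix products -/

/-- The trilinear map `(X, Y, Z) ↦ XYZ` on matrices. -/
noncomputable def mulXYZ (n : ℕ) : Matrix (Fin n) (Fin n) ℂ →ₗ[ℂ] Matrix (Fin n) (Fin n) ℂ →ₗ[ℂ]
    Matrix (Fin n) (Fin n) ℂ →ₗ[ℂ] Matrix (Fin n) (Fin n) ℂ :=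
  (LinearMap.mul ℂ (Matrix (Fin n) (Fin n) ℂ)).compr₂ (LinearMap.mul ℂ _)

theorem mulXYZ_apply (X Y Z : Matrix (Fin n) (Fin n) ℂ) : mulXYZ n X Y Z = X * Y * Z := rfl

/-- The trilinear map `(X, Y, Z) ↦ XZY` on matrices. -/
noncomputable def mulXZY (n : ℕ) : Matrix (Fin n) (Fin n) ℂ →ₗ[ℂ] Matrix (Fin n) (Fin n) ℂ →ₗ[ℂ]
    Matrix (Fin n) (Fin n) ℂ →ₗ[ℂ] Matrix (Fin n) (Fin n) ℂ :=
  LinearMap.lflip.toLinearMap ∘ₗ mulXYZ n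

theorem mulXZY_apply (X Y Z : Matrix (Fin n) (Fin n) ℂ) : mulXZY n X Y Z = X * Z * Y := rfl

theorem mulXYZ_equivariant (P X Y Z : Matrix (Fin n) (Fin n) ℂ) :
    mulXYZ n (P * X - X * P) Y Z + mulXYZ n X (P * Y - Y * P) Z + mulXYZ n X Y (P * Z - Z * P) =
      P * mulXYZ n X Y Z - mulXYZ n X Y Z * P := by
  simp only [mulXYZ_apply]; noncomm_ring

theorem mulYXZ_equivariant (P X Y Z : Matrix (Fin n) (Fin n) ℂ) :
    (mulXYZ n).flip (P * X - X * P) Y Z + (mulXYZ n).flip X (P * Y - Y * P) Z +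
      (mulXYZ n).flip X Y (P * Z - Z * P) =
      P * (mulXYZ n).flip X Y Z - (mulXYZ n).flip X Y Z * P := by
  simp only [LinearMap.flip_apply, mulXYZ_apply]; noncomm_ring

theorem mulXZY_equivariant (P X Y Z : Matrix (Fin n) (Fin n) ℂ) :
    mulXZY n (P * X - X * P) Y Z + mulXZY n X (P * Y - Y * P) Z + mulXZY n X Y (P * Z - Z * P) =
      P * mulXZY n X Y Z - mulXZY n X Y Z * P := by
  simp only [mulXZY_apply]; noncomm_ring

/-! ### Coordinates and the dimension count -/

/-- The four coordinates that determine a morphism `g ⊗ g → Λ²g`. -/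
noncomputable def skewCoords (p q r : Fin n) :
    (sl n ⊗[ℂ] sl n →ₗ⁅ℂ, sl n⁆ skewSquare (sl n)) →ₗ[ℂ] Fin 4 → ℂ where
  toFun h := ![skewValue p q h (Matrix.single q p 1) (Matrix.single p q 1),
    skewValue p q h (Matrix.single p r 1) (Matrix.single r p 1),
    skewValue p q h (Matrix.single r q 1) (Matrix.single q r 1),
    skewValue p q h (Matrix.single p p 1) (Matrix.single q q 1)]
  map_add' g h := by simp
  map_smul' c h := by simp

theorem skewCoords_injective {p q r : Fin n} (hpq : p ≠ q) (hrp : r ≠ p) (hrq : r ≠ q) :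
    Function.Injective (skewCoords p q r) := by
  rw [injective_iff_map_eq_zero]
  intro h hh
  exact eq_zero_of_skewValue_eq_zero hpq h <|
    skew_form_eq_zero_of_ne hpq hrp hrq _ (skewValue_skew p q h) (skewValue_one p q h)
      (skewValue_invariant hpq h) (congrFun hh 0) (congrFun hh 1) (congrFun hh 2) (congrFun hh 3)

theorem toSl_single_self_val (i : Fin n) :
    (toSl n (Matrix.single i i 1)).1 =
      Matrix.single i i 1 - (n : ℂ)⁻¹ • (1 : Matrix (Fin n) (Fin n) ℂ) := by
  rw [toSl_val, Matrix.trace_single_eq_same, one_smul]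

theorem skewCoords_antisymmetrize {p q r : Fin n} (hpq : p ≠ q) (hrp : r ≠ p) (hrq : r ≠ q) :
    skewCoords p q r antisymmetrize = ![1, 0, 0, 0] := by
  simp [skewCoords, skewValue_antisymmetrize, toSl_single_val, toSl_single_self_val, hpq,
    hpq.symm, hrp, hrq, hrp.symm, hrq.symm, mul_sub]

theorem skewCoords_mulXYZ {p q r : Fin n} (hpq : p ≠ q) (hrp : r ≠ p) (hrq : r ≠ q) :
    skewCoords p q r (trilinearSkew (mulXYZ n) mulXYZ_equivariant) = ![-1, 1, 0, 0] := by
  simp [skewCoords, skewValue_trilinearSkew, mulXYZ_apply, toSl_single_val, toSl_single_self_val,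
    hpq, hpq.symm, hrp, hrq, hrp.symm, hrq.symm, mul_sub, sub_mul]
  ring

theorem skewCoords_mulYXZ {p q r : Fin n} (hpq : p ≠ q) (hrp : r ≠ p) (hrq : r ≠ q) :
    skewCoords p q r (trilinearSkew (mulXYZ n).flip mulYXZ_equivariant) = ![1, 0, -1, 0] := by
  simp [skewCoords, skewValue_trilinearSkew, mulXYZ_apply, toSl_single_val, toSl_single_self_val,
    hpq, hpq.symm, hrp, hrq, hrp.symm, hrq.symm, mul_sub, sub_mul]
  ring

/-- The last entry is (1/n)² - (1 - 1/n)², from the diagonal entries of the traceless parts of E_pp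
and E_qq. -/
theorem skewCoords_mulXZY {p q r : Fin n} (hpq : p ≠ q) (hrp : r ≠ p) (hrq : r ≠ q) :
    skewCoords p q r (trilinearSkew (mulXZY n) mulXZY_equivariant) =
      ![0, 0, 0, 2 * (n : ℂ)⁻¹ - 1] := by
  simp [skewCoords, skewValue_trilinearSkew, mulXZY_apply, toSl_single_val, toSl_single_self_val,
    hpq, hpq.symm, hrp, hrq, hrp.symm, hrq.symm, mul_sub, sub_mul]
  ring

theorem surjective_of_triangular {E : Type*} [AddCommGroup E] [Module ℂ E]
    (f : E →ₗ[ℂ] Fin 4 → ℂ) {a b c d : E} {z : ℂ} (hz : z ≠ 0) (ha : f a = ![1, 0, 0, 0])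
    (hb : f b = ![-1, 1, 0, 0]) (hc : f c = ![1, 0, -1, 0]) (hd : f d = ![0, 0, 0, z]) :
    Function.Surjective f := by
  intro v
  refine ⟨(v 0 + v 1 + v 2) • a + v 1 • b + (-v 2) • c + (v 3 * z⁻¹) • d, ?_⟩
  rw [map_add, map_add, map_add, map_smul, map_smul, map_smul, map_smul, ha, hb, hc, hd]
  ext i
  fin_cases i
  · simp; ring
  · simp
  · simp
  · simp [mul_assoc, inv_mul_cancel₀ hz]

theorem skewCoords_surjective (hn : 3 ≤ n) {p q r : Fin n} (hpq : p ≠ q) (hrp : r ≠ p)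
    (hrq : r ≠ q) : Function.Surjective (skewCoords p q r) := by
  -- This coefficient vanishes exactly when n = 2.
  have hc : 2 * (n : ℂ)⁻¹ - 1 ≠ 0 := by
    have h0 : (n : ℂ) ≠ 0 := Nat.cast_ne_zero.2 (by omega)
    intro h
    have h2 : (2 : ℂ) = n := by field_simp at h; linear_combination h
    have h3 : 2 = n := by exact_mod_cast h2
    omega
  exact surjective_of_triangular _ hc (skewCoords_antisymmetrize hpq hrp hrq)
    (skewCoords_mulXYZ hpq hrp hrq) (skewCoords_mulYXZ hpq hrp hrq)
    (skewCoords_mulXZY hpq hrp hrq)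

/-- `Hom_g(g, Λ²g ⊗ g) ≃ Hom_g(g ⊗ g, Λ²g)`. -/
noncomputable def homSkewEquiv (n : ℕ) :
    (sl n →ₗ⁅ℂ, sl n⁆ skewSquare (sl n) ⊗[ℂ] sl n) ≃ₗ[ℂ]
      (sl n ⊗[ℂ] sl n →ₗ⁅ℂ, sl n⁆ skewSquare (sl n)) :=
  (postcompEquiv tensorComm).trans (homContract (skewSquare (sl n)))

theorem finrank_hom_skewSquare (hn : 3 ≤ n) :
    finrank ℂ (sl n →ₗ⁅ℂ, sl n⁆ skewSquare (sl n) ⊗[ℂ] sl n) = 4 := by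
  let p : Fin n := ⟨0, by omega⟩
  let q : Fin n := ⟨1, by omega⟩
  let r : Fin n := ⟨2, by omega⟩
  have hpq : p ≠ q := by simp [p, q]
  have hrp : r ≠ p := by simp [p, r]
  have hrq : r ≠ q := by simp [q, r]
  rw [(homSkewEquiv n).finrank_eq, (LinearEquiv.ofBijective (skewCoords p q r)
    ⟨skewCoords_injective hpq hrp hrq, skewCoords_surjective hn hpq hrp hrq⟩).finrank_eq,
    finrank_fin_fun]

theorem finrank_hom_skewSquare_of_eq_two (hn : n = 2) :
    finrank ℂ (sl n →ₗ⁅ℂ, sl n⁆ skewSquare (sl n) ⊗[ℂ] sl n) = 1 := by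
  let p : Fin n := ⟨0, by omega⟩
  let q : Fin n := ⟨1, by omega⟩
  have hpq : p ≠ q := by simp [p, q]
  have hk : ∀ k : Fin n, k ≠ p → k ≠ q → False := by
    intro k h0 h1
    simp only [p, q, ne_eq, Fin.ext_iff] at h0 h1
    omega
  let c := (LinearMap.applyₗ (Matrix.single p q (1 : ℂ))) ∘ₗ
    (LinearMap.applyₗ (Matrix.single q p (1 : ℂ))) ∘ₗ skewValue p q
  have hc : ∀ h, c h = skewValue p q h (Matrix.single q p 1) (Matrix.single p q 1) :=
    fun h => rfl
  have hinj : Function.Injective c := by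
    rw [injective_iff_map_eq_zero]
    intro h hh
    -- With only the indices p and q, β(E_pp, 1) = 0 and β(E_pp, E_pp) = 0 leave β(E_pp, E_qq) = 0,
    -- so a single coordinate survives.
    have hone := skewValue_one p q h (Matrix.single p p 1)
    rw [← sum_single_self, map_sum,
      Fintype.sum_eq_add p q hpq (fun k hk' => (hk k hk'.1 hk'.2).elim),
      self_eq_neg.1 (skewValue_skew p q h (Matrix.single p p 1) (Matrix.single p p 1)),
      zero_add] at hone
    exact eq_zero_of_skewValue_eq_zero hpq h <|
      skew_form_eq_zero hpq _ (skewValue_skew p q h) (skewValue_one p q h)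
        (skewValue_invariant hpq h) hh (fun k h0 h1 => (hk k h0 h1).elim)
        (fun k h0 h1 => (hk k h0 h1).elim) hone
  have hne : c antisymmetrize = 1 := by
    rw [hc, skewValue_antisymmetrize hpq, toSl_single_val hpq, toSl_single_val hpq.symm]
    simp [hpq]
  have hsurj : Function.Surjective c :=
    LinearMap.surjective fun h => one_ne_zero (hne.symm.trans (LinearMap.congr_fun h _))
  rw [(homSkewEquiv n).finrank_eq, (LinearEquiv.ofBijective c ⟨hinj, hsurj⟩).finrank_eq,
    finrank_self]

end SpecialLinear

/-! ### Morphisms into a kernel -/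

section Kernel

variable {L : Type*} [LieRing L] [LieAlgebra ℂ L]
variable {V M N : Type*}
  [AddCommGroup V] [Module ℂ V] [LieRingModule L V] [LieModule ℂ L V]
  [AddCommGroup M] [Module ℂ M] [LieRingModule L M] [LieModule ℂ L M]
  [AddCommGroup N] [Module ℂ N] [LieRingModule L N] [LieModule ℂ L N]

/-- `Hom(V, ker f)` is the kernel of postcomposition with `f`. -/
noncomputable def homKerEquiv (f : M →ₗ⁅ℂ, L⁆ N) :
    (V →ₗ⁅ℂ, L⁆ f.ker) ≃ₗ[ℂ] LinearMap.ker (postcomp (V := V) f) where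
  toFun g := ⟨f.ker.incl.comp g, by
    ext v
    exact LieModuleHom.mem_ker.1 (g v).2⟩
  map_add' g h := by ext; rfl
  map_smul' c g := by ext; rfl
  invFun g := g.1.codRestrict f.ker fun v =>
    LieModuleHom.mem_ker.2 (LieModuleHom.congr_fun g.2 v)
  left_inv g := by ext; rfl
  right_inv g := by ext; rfl

end Kernel
end CartanSl

theorem mainTheorem7 (n : ℕ) (hn : 2 ≤ n) :
    (3 ≤ n →
      Module.finrank ℂ (CartanSl.sl n →ₗ⁅ℂ, CartanSl.sl n⁆
        CartanSl.skewSquare (CartanSl.sl n) ⊗[ℂ] CartanSl.sl n) = 4) ∧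
    (n = 2 →
      Module.finrank ℂ (CartanSl.sl n →ₗ⁅ℂ, CartanSl.sl n⁆
        CartanSl.skewSquare (CartanSl.sl n) ⊗[ℂ] CartanSl.sl n) = 1) ∧
    Module.finrank ℂ (CartanSl.sl n →ₗ⁅ℂ, CartanSl.sl n⁆
      CartanSl.sl n ⊗[ℂ] CartanSl.cartanSquare n hn) = 1 ∧
    (3 ≤ n →
      3 ≤ Module.finrank ℂ (CartanSl.sl n →ₗ⁅ℂ, CartanSl.sl n⁆ (CartanSl.Phi n hn).ker)) := by
  refine ⟨fun h => CartanSl.finrank_hom_skewSquare h,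
    fun h => CartanSl.finrank_hom_skewSquare_of_eq_two h, CartanSl.finrank_hom_cartanSquare hn,
    fun h => ?_⟩
  · have h4 := CartanSl.finrank_hom_skewSquare h
    have h1 := CartanSl.finrank_hom_cartanSquare hn
    -- `finrank` is 0 by default in infinite dimension, so a positive value yields the finiteness
    -- needed for rank-nullity and for bounding the rank by 1.
    have := FiniteDimensional.of_finrank_pos (h4 ▸ (by norm_num : 0 < 4))
    have := FiniteDimensional.of_finrank_pos (h1 ▸ (by norm_num : 0 < 1))
    rw [(CartanSl.homKerEquiv (CartanSl.Phi n hn)).finrank_eq]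
    have hr := LinearMap.finrank_range_add_finrank_ker
      (CartanSl.postcomp (V := CartanSl.sl n) (CartanSl.Phi n hn))
    have hle := Submodule.finrank_le
      (LinearMap.range (CartanSl.postcomp (V := CartanSl.sl n) (CartanSl.Phi n hn)))
    omega
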